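/- Let $q\ge 2$ be an integer, let $F$ be an alphabet with $q$ elements (for instance $F=\mathbb{F}_q$ when $q$ is a prime power), and endow $F^n$ with the Hamming distance. Let $A^{(q)}(n,d)$ be the largest cardinality of a code $C\subseteq F^n$ with minimum distance at least $d$. Let $A^{(q)}_{\mathrm{LP}}(n,d)$ be the maximum of Delsarte's linear program for the Hamming scheme: $$\text{maximize } \sum_{t=0}^n u(t) \quad\text{subject to}\quad u(0)=1,\quad u(t)=0 \ (1\le t\le d-1),\quad u(t)\ge 0\ (d\le t\le n),\quad \sum_{t=0}^n u(t)\,q_i(t)\ge 0\ (0\le i\le n),$$ where $q_i(t)$ are the $q$-numbers of the scheme, defined by $E_i=q^{-n}\sum_{t=0}^n q_i(t)D_t$. Here $D_t$ is the matrix of the relation "at Hamming distance $t$", and $E_0,\dots,E_n$ are the orthogonal projectors of the scheme in the canonical order: $E_i$ is the sum, over all sets $S$ of $i$ coordinates, of the tensor product of $I-\frac1qJ$ at the coordinates in $S$ and $\frac1qJ$ at the others ($J$ being the $q\times q$ all-ones matrix). Equivalently, $q_i(t)=\sum_{s=0}^{i}(-1)^s(q-1)^{i-s}\binom{t}{s}\binom{n-t}{i-s}$.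 (1) For every $n\ge 2$ and every integer $d$ with $0\le d\le n(q-1)/q$, the maximum $A^{(q)}_{\mathrm{LP}}(n,d)$ is attained and $$A^{(q)}(n,d)\le A^{(q)}_{\mathrm{LP}}(n,d).$$ If moreover $d\ge 1$, then $$A^{(q)}_{\mathrm{LP}}(n,d)\le qd\cdot\frac{q^n}{\binom nu (q-1)^u},\qquad u=\left\lfloor n\,\frac{q-1}{q}\left(1-\sqrt{1-\frac{qd-1}{(q-1)n}}\right)\right\rfloor .$$ (2) Let $$R^{(q)}(\delta)=\limsup_{n\to\infty}\frac1n\log_q A^{(q)}(n,\lfloor\delta n\rfloor),\qquad R^{(q)}_{\mathrm{LP}}(\delta)=\limsup_{n\to\infty}\frac1n\log_q A^{(q)}_{\mathrm{LP}}(n,\lfloor\delta n\rfloor).$$ For every real $\delta\in[0,(q-1)/q]$, $$R^{(q)}(\delta)\le R^{(q)}_{\mathrm{LP}}(\delta)\le 1-h_q(J_q(\delta)),$$ where $h_q(x)=-(1-x)\log_q(1-x)-x\log_q\frac{x}{q-1}$ (with $0\log_q 0=0$) and $J_q(\delta)=\frac{q-1}{q}\left(1-\sqrt{1-\frac{q\delta}{q-1}}\right)$.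 -/

import Mathlib

noncomputable section

namespace DelsarteLP

open Finset

/-! ### Schemes given by a distance function: adjacency matrices, valencies, q-numbers -/

/-- The adjacency matrix `D_i` of a distance function `τ`: the entry at `(x, y)` is `1` if
`τ x y = i` and `0` otherwise. -/
def adjMat {X : Type*} (τ : X → X → ℕ) (i : ℕ) : Matrix X X ℝ :=
  Matrix.of fun x y => if τ x y = i then 1 else 0

/-- The inner product `⟨A, B⟩ = tr (A Bᵀ)` of real square matrices. -/
def matInner {X : Type*} [Fintype X] (A B : Matrix X X ℝ) : ℝ := (A * B.transpose).trace

/-- The valency `v_i = ‖D_i‖² / |X|`. -/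
def valency {X : Type*} [Fintype X] (τ : X → X → ℕ) (i : ℕ) : ℝ :=
  matInner (adjMat τ i) (adjMat τ i) / Fintype.card X

/-- The q-number `q_i(j)`: the coefficients in `E_i = |X|⁻¹ ∑ⱼ q_i(j) D_j`. As the `D_j` are
pairwise orthogonal and `‖D_j‖² = |X| v_j`, the coefficient `q_i(j)` is `⟨E_i, D_j⟩ / v_j`.
(For the Hamming scheme, the expansion is `hammingE_expansion` below.) -/
def qNumber {X : Type*} [Fintype X] (τ : X → X → ℕ) (E : ℕ → Matrix X X ℝ) (i j : ℕ) : ℝ :=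
  matInner (E i) (adjMat τ j) / valency τ j

/-! ### Delsarte's linear program -/

/-- The constraints of Delsarte's linear program, for a function `u` on `{0, …, n}`, a minimum
distance `d` and the q-numbers `Q i t = q_i(t)`. -/
structure Feasible (n d : ℕ) (Q : ℕ → ℕ → ℝ) (u : Fin (n + 1) → ℝ) : Prop where
  zero : u 0 = 1
  gap : ∀ t : Fin (n + 1), 1 ≤ (t : ℕ) → (t : ℕ) < d → u t = 0
  nonneg : ∀ t : Fin (n + 1), d ≤ (t : ℕ) → 0 ≤ u t
  dual : ∀ i : Fin (n + 1), 0 ≤ ∑ t : Fin (n + 1), u t * Q i t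

/-- The set of values of the objective function on the feasible points. -/
def lpValues (n d : ℕ) (Q : ℕ → ℕ → ℝ) : Set ℝ :=
  {s | ∃ u : Fin (n + 1) → ℝ, Feasible n d Q u ∧ s = ∑ t, u t}

/-! ### The Hamming scheme over an alphabet `F`, with its canonical ordering -/

/-- The canonical ordering of the projectors of the Hamming scheme on `F ^ n`. With `q = |F|`, the
space of functions on `F` splits into the constants, with projector `J / q`, and their
complement, with projector `I - J / q`; `E_i` is the sum, over the sets `S` of `i` coordinates,
of the tensor product of `I - J / q` at the coordinates in `S` and `J / q` at the others. -/
def hammingE (F : Type*) [Fintype F] [DecidableEq F] (n i : ℕ) :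
    Matrix (Fin n → F) (Fin n → F) ℝ :=
  Matrix.of fun x y => ∑ S ∈ powersetCard i (univ : Finset (Fin n)),
    ∏ l, if l ∈ S then ((if x l = y l then 1 else 0) - 1 / (Fintype.card F : ℝ))
      else 1 / (Fintype.card F : ℝ)

/-- The q-numbers of the Hamming scheme. -/
def hammingQ (F : Type*) [Fintype F] [DecidableEq F] (n i j : ℕ) : ℝ :=
  qNumber (fun x y : Fin n → F => hammingDist x y) (hammingE F n) i j

/-- `A_LP^(q)(n, d)`: the maximum of Delsarte's linear program for the Hamming scheme. -/
def hammingALP (F : Type*) [Fintype F] [DecidableEq F] (n d : ℕ) : ℝ :=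
  sSup (lpValues n d (hammingQ F n))

/-- The code `C` has minimum Hamming distance at least `d`. -/
def MinDistGE {F : Type*} [DecidableEq F] {n : ℕ} (C : Finset (Fin n → F)) (d : ℕ) : Prop :=
  ∀ c ∈ C, ∀ c' ∈ C, c ≠ c' → d ≤ hammingDist c c'

open Classical in
/-- `A^(q)(n, d)`: the largest size of a code in `F ^ n` with minimum distance at least `d`. -/
def maxCodeSize (F : Type*) [Fintype F] [DecidableEq F] (n d : ℕ) : ℕ :=
  ((univ : Finset (Finset (Fin n → F))).filter fun C => MinDistGE C d).sup card

/-- `R^(q)(δ)`, the upper limit of `log_q A^(q)(n, ⌊δ n⌋) / n`. -/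
def rate (F : Type*) [Fintype F] [DecidableEq F] (δ : ℝ) : EReal :=
  Filter.limsup (fun n : ℕ =>
    (((1 / (n : ℝ)) * Real.logb (Fintype.card F) (maxCodeSize F n ⌊δ * n⌋₊ : ℝ) : ℝ) : EReal))
    Filter.atTop

/-- `R_LP^(q)(δ)`, the upper limit of `log_q A_LP^(q)(n, ⌊δ n⌋) / n`. -/
def rateLP (F : Type*) [Fintype F] [DecidableEq F] (δ : ℝ) : EReal :=
  Filter.limsup (fun n : ℕ =>
    (((1 / (n : ℝ)) * Real.logb (Fintype.card F) (hammingALP F n ⌊δ * n⌋₊) : ℝ) : EReal))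
    Filter.atTop

/-! ### The functions in the bounds -/

/-- The integer `u` of the Elias-Bassalygo bound. -/
def ebRadius (q n d : ℕ) : ℕ :=
  ⌊(n : ℝ) * (((q : ℝ) - 1) / q) *
    (1 - Real.sqrt (1 - ((q : ℝ) * d - 1) / (((q : ℝ) - 1) * n)))⌋₊

/-- The `q`-ary entropy. -/
def qEntropy (q : ℕ) (x : ℝ) : ℝ :=
  -(1 - x) * Real.logb q (1 - x) - x * Real.logb q (x / ((q : ℝ) - 1))

/-- `J_q(δ)`. -/
def johnson (q : ℕ) (δ : ℝ) : ℝ :=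
  (((q : ℝ) - 1) / q) * (1 - Real.sqrt (1 - (q : ℝ) * δ / ((q : ℝ) - 1)))

/-! ### The matrices `hammingE` are the projectors, and `hammingQ` their coefficients -/

/-- `E_0 = J / |X|`. -/
theorem hammingE_zero (F : Type*) [Fintype F] [DecidableEq F] (n : ℕ) (x y : Fin n → F) :
    hammingE F n 0 x y = 1 / (Fintype.card (Fin n → F) : ℝ) := by
  simp [hammingE]

/-- `∑ E_i = I`. -/
theorem hammingE_sum (F : Type*) [Fintype F] [DecidableEq F] (n : ℕ) :
    ∑ i ∈ range (n + 1), hammingE F n i = 1 := by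
  ext x y
  rw [Matrix.sum_apply]
  simp only [hammingE, Matrix.of_apply]
  have h1 : ∀ g : Finset (Fin n) → ℝ, ∑ i ∈ range (n + 1),
      ∑ S ∈ powersetCard i (univ : Finset (Fin n)), g S = ∑ S : Finset (Fin n), g S := by
    intro g
    have := Finset.sum_powerset (univ : Finset (Fin n)) g
    simp only [card_univ, Fintype.card_fin, powerset_univ] at this
    exact this.symm
  rw [h1]
  have h2 := Fintype.prod_add
    (fun l => ((if x l = y l then (1 : ℝ) else 0) - 1 / (Fintype.card F : ℝ)))
    (fun _ : Fin n => 1 / (Fintype.card F : ℝ))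
  have h3 : ∀ S : Finset (Fin n), (∏ l, if l ∈ S then
      ((if x l = y l then (1 : ℝ) else 0) - 1 / (Fintype.card F : ℝ))
      else 1 / (Fintype.card F : ℝ)) =
      (∏ l ∈ S, ((if x l = y l then (1 : ℝ) else 0) - 1 / (Fintype.card F : ℝ))) *
      ∏ l ∈ Sᶜ, 1 / (Fintype.card F : ℝ) := by
    intro S
    rw [← Finset.prod_mul_prod_compl S]
    congr 1
    · exact Finset.prod_congr rfl fun l hl => by rw [if_pos hl]
    · exact Finset.prod_congr rfl fun l hl => by rw [if_neg (by simpa using hl)]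
  simp_rw [h3]
  rw [← h2]
  simp only [sub_add_cancel]
  by_cases hxy : x = y
  · subst hxy; simp
  · obtain ⟨l, hl⟩ := Function.ne_iff.mp hxy
    rw [Matrix.one_apply_ne hxy]
    exact Finset.prod_eq_zero (mem_univ l) (if_neg hl)

/-- The `E_i` are pairwise orthogonal idempotents. -/
theorem hammingE_mul (F : Type*) [Fintype F] [DecidableEq F] [Nonempty F] (n i j : ℕ) :
    hammingE F n i * hammingE F n j = if i = j then hammingE F n i else 0 := by
  have hq : (Fintype.card F : ℝ) ≠ 0 := by exact_mod_cast Fintype.card_ne_zero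
  set c : ℝ := 1 / (Fintype.card F : ℝ) with hc
  have hqc : (Fintype.card F : ℝ) * c = 1 := by rw [hc]; field_simp
  let M : Prop → F → F → ℝ := fun p a b => by
    classical exact if p then ((if a = b then 1 else 0) - c) else c
  have key : ∀ p r : Prop, ∀ a b : F, ∑ e, M p a e * M r e b =
      (by classical exact if (p ↔ r) then M p a b else 0) := by
    intro p r a b
    by_cases hp : p <;> by_cases hr : r <;>
      simp [M, hp, hr, mul_sub, sub_mul, Finset.sum_sub_distrib, ← Finset.sum_mul,
        ← Finset.mul_sum, hqc, ← mul_assoc]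
  have hE : ∀ k (x y : Fin n → F), hammingE F n k x y =
      ∑ S ∈ powersetCard k (univ : Finset (Fin n)), ∏ l, M (l ∈ S) (x l) (y l) := by
    intro k x y
    simp only [hammingE, Matrix.of_apply, M]
    refine Finset.sum_congr rfl fun S _ => Finset.prod_congr rfl fun l _ => ?_
    by_cases h : l ∈ S <;> simp [h, hc]
  have hprod : ∀ (S T : Finset (Fin n)) (x z : Fin n → F),
      ∑ y : Fin n → F, (∏ l, M (l ∈ S) (x l) (y l)) * (∏ l, M (l ∈ T) (y l) (z l)) =
      if S = T then ∏ l, M (l ∈ S) (x l) (z l) else 0 := by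
    intro S T x z
    simp_rw [← Finset.prod_mul_distrib]
    rw [← Fintype.prod_sum (fun l e => M (l ∈ S) (x l) e * M (l ∈ T) e (z l))]
    simp_rw [key]
    by_cases h : S = T
    · subst h; simp
    · rw [if_neg h]
      obtain ⟨l, hl⟩ : ∃ l, ¬ (l ∈ S ↔ l ∈ T) := by
        by_contra hcon; push Not at hcon; exact h (Finset.ext hcon)
      exact Finset.prod_eq_zero (mem_univ l) (if_neg hl)
  ext x z
  rw [Matrix.mul_apply]
  simp_rw [hE, Finset.sum_mul_sum]
  rw [Finset.sum_comm]
  simp_rw [Finset.sum_comm (s := (univ : Finset (Fin n → F)))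
    (t := powersetCard j (univ : Finset (Fin n))), hprod]
  by_cases hij : i = j
  · subst hij
    rw [if_pos rfl, hE]
    refine Finset.sum_congr rfl fun S hS => ?_
    rw [Finset.sum_ite_eq, if_pos hS]
  · rw [if_neg hij]
    refine Finset.sum_eq_zero fun S hS => Finset.sum_eq_zero fun T hT => if_neg ?_
    rintro rfl
    exact hij ((mem_powersetCard.mp hS).2.symm.trans (mem_powersetCard.mp hT).2)

/-- The value `K_k(j)` of the Krawtchouk polynomial of parameters `n`, `q`. -/
def krawtchouk (q n k j : ℕ) : ℝ :=
  ∑ s ∈ range (k + 1),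
    (-1) ^ s * ((q : ℝ) - 1) ^ (k - s) * (j.choose s : ℝ) * ((n - j).choose (k - s) : ℝ)

theorem hammingE_apply (F : Type*) [Fintype F] [DecidableEq F] [Nonempty F] (n k : ℕ)
    (x y : Fin n → F) : hammingE F n k x y =
      (1 / (Fintype.card (Fin n → F) : ℝ)) * krawtchouk (Fintype.card F) n k (hammingDist x y) := by
  have hq : (Fintype.card F : ℝ) ≠ 0 := by exact_mod_cast Fintype.card_ne_zero
  set q : ℕ := Fintype.card F with hqdef
  set a : Fin n → ℝ := fun l => if x l = y l then (q : ℝ) - 1 else -1 with ha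
  have h1 : hammingE F n k x y = (1 / (Fintype.card (Fin n → F) : ℝ)) *
      ∑ S ∈ powersetCard k (univ : Finset (Fin n)), ∏ l ∈ S, a l := by
    simp only [hammingE, Matrix.of_apply]
    rw [Finset.mul_sum]
    refine Finset.sum_congr rfl fun S _ => ?_
    have : ∀ l, (if l ∈ S then ((if x l = y l then (1 : ℝ) else 0) - 1 / (q : ℝ))
        else 1 / (q : ℝ)) = (1 / (q : ℝ)) * (if l ∈ S then a l else 1) := by
      intro l
      by_cases h : l ∈ S <;> by_cases h' : x l = y l <;> simp [h, h', ha] <;> field_simp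
    simp_rw [← hqdef, this]
    rw [Finset.prod_mul_distrib]
    simp [Finset.prod_ite_mem, ← hqdef]
  rw [h1]
  congr 1
  have hpoly : ∀ (c : ℝ) (m t : ℕ),
      ((1 + Polynomial.C c * Polynomial.X) ^ m).coeff t = c ^ t * (m.choose t : ℝ) := by
    intro c m t
    rw [add_comm, add_pow]
    simp only [one_pow, mul_one, mul_pow, ← Polynomial.C_pow, Polynomial.finsetSum_coeff,
      ← Polynomial.C_eq_natCast, Polynomial.coeff_mul_C, Polynomial.coeff_C_mul,
      Polynomial.coeff_X_pow]
    simp only [mul_ite, mul_one, mul_zero, ite_mul, zero_mul, Finset.sum_ite_eq, mem_range]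
    split_ifs with h
    · rfl
    · rw [Nat.choose_eq_zero_of_lt (by omega)]; simp
  have hL : (∏ l, (1 + Polynomial.C (a l) * Polynomial.X)).coeff k =
      ∑ S ∈ powersetCard k (univ : Finset (Fin n)), ∏ l ∈ S, a l := by
    simp_rw [add_comm (1 : Polynomial ℝ)]
    rw [Fintype.prod_add]
    simp only [Finset.prod_mul_distrib, prod_const_one, mul_one, prod_const,
      Polynomial.finsetSum_coeff]
    simp_rw [← map_prod, Polynomial.coeff_C_mul, Polynomial.coeff_X_pow]
    simp only [mul_ite, mul_one, mul_zero]
    rw [← Finset.sum_filter]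
    refine Finset.sum_congr ?_ fun _ _ => rfl
    ext S
    simp [mem_powersetCard, eq_comm]
  have hd : ∀ l, (1 + Polynomial.C (a l) * Polynomial.X) = if x l ≠ y l then
      (1 + Polynomial.C (-1 : ℝ) * Polynomial.X) else
      (1 + Polynomial.C ((q : ℝ) - 1) * Polynomial.X) := by
    intro l
    by_cases h : x l = y l <;> simp [ha, h]
  have hcard : (univ.filter fun l => ¬ (x l ≠ y l)).card = n - hammingDist x y := by
    have := Finset.card_filter_add_card_filter_not (s := (univ : Finset (Fin n)))
      (fun l => x l ≠ y l)
    simp only [card_univ, Fintype.card_fin] at this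
    simp only [hammingDist]
    omega
  rw [← hL]
  simp_rw [hd]
  rw [Finset.prod_ite, prod_const, prod_const, hcard]
  change ((1 + Polynomial.C (-1 : ℝ) * Polynomial.X) ^ hammingDist x y * _).coeff k = _
  rw [Polynomial.coeff_mul, Finset.Nat.sum_antidiagonal_eq_sum_range_succ_mk]
  simp only [hpoly, krawtchouk]
  refine Finset.sum_congr rfl fun s _ => ?_
  ring

theorem matInner_adjMat {X : Type*} [Fintype X] (A : Matrix X X ℝ) (τ : X → X → ℕ) (j : ℕ) :
    matInner A (adjMat τ j) = ∑ x, ∑ y, if τ x y = j then A x y else 0 := by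
  simp [matInner, Matrix.trace, Matrix.mul_apply, adjMat]

theorem hammingQ_hammingDist (F : Type*) [Fintype F] [DecidableEq F] [Nonempty F] (n i : ℕ)
    (x y : Fin n → F) :
    hammingQ F n i (hammingDist x y) = krawtchouk (Fintype.card F) n i (hammingDist x y) := by
  set j := hammingDist x y with hj
  set τ : (Fin n → F) → (Fin n → F) → ℕ := fun x y => hammingDist x y with hτ
  have hX : (Fintype.card (Fin n → F) : ℝ) ≠ 0 := by exact_mod_cast Fintype.card_ne_zero
  set N : ℝ := ∑ x : Fin n → F, ∑ y : Fin n → F, if τ x y = j then (1 : ℝ) else 0 with hN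
  have hpos : N ≠ 0 := by
    refine ne_of_gt ?_
    refine Finset.sum_pos' (fun _ _ => Finset.sum_nonneg fun _ _ => by split_ifs <;> norm_num)
      ⟨x, mem_univ _, ?_⟩
    refine Finset.sum_pos' (fun _ _ => by split_ifs <;> norm_num) ⟨y, mem_univ _, ?_⟩
    simp [hτ, hj]
  have hE : matInner (hammingE F n i) (adjMat τ j) =
      (1 / (Fintype.card (Fin n → F) : ℝ)) * krawtchouk (Fintype.card F) n i j * N := by
    rw [matInner_adjMat, hN, Finset.mul_sum]
    refine Finset.sum_congr rfl fun x' _ => ?_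
    rw [Finset.mul_sum]
    refine Finset.sum_congr rfl fun y' _ => ?_
    by_cases h : τ x' y' = j
    · rw [if_pos h, if_pos h, hammingE_apply, mul_one, ← h]
    · rw [if_neg h, if_neg h, mul_zero]
  have hv : valency τ j = N / Fintype.card (Fin n → F) := by
    rw [valency, matInner_adjMat]
    congr 1
    refine Finset.sum_congr rfl fun x' _ => Finset.sum_congr rfl fun y' _ => ?_
    by_cases h : τ x' y' = j <;> simp [adjMat, h]
  change matInner (hammingE F n i) (adjMat τ j) / valency τ j = _
  rw [hE, hv]
  field_simp

/-- The defining property of the q-numbers: `E_i = |X|⁻¹ ∑ⱼ q_i(j) D_j`. -/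
theorem hammingE_expansion (F : Type*) [Fintype F] [DecidableEq F] [Nonempty F] (n i : ℕ) :
    hammingE F n i = (1 / (Fintype.card (Fin n → F) : ℝ)) • ∑ j ∈ range (n + 1),
      hammingQ F n i j • adjMat (fun x y : Fin n → F => hammingDist x y) j := by
  ext x y
  have hle : hammingDist x y < n + 1 :=
    Nat.lt_succ_of_le (by simpa using hammingDist_le_card_fintype (x := x) (y := y))
  rw [hammingE_apply, Matrix.smul_apply, Matrix.sum_apply]
  simp [adjMat, hle, hammingQ_hammingDist]

/-- The q-numbers of the Hamming scheme are the values of the Krawtchouk polynomials. -/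
theorem hammingQ_eq_krawtchouk (F : Type*) [Fintype F] [DecidableEq F] [Nontrivial F]
    (n i j : ℕ) (hj : j ≤ n) : hammingQ F n i j = krawtchouk (Fintype.card F) n i j := by
  obtain ⟨a, b, hab⟩ := exists_pair_ne F
  have h : hammingDist (fun _ : Fin n => a) (fun l : Fin n => if (l : ℕ) < j then b else a) = j := by
    have : ∀ l : Fin n, (a ≠ if (l : ℕ) < j then b else a) ↔ (l : ℕ) < j := by
      intro l; by_cases h : (l : ℕ) < j <;> simp [h, hab]
    simp only [hammingDist, this]
    rw [Fin.card_filter_val_lt]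
    omega
  rw [← h]
  exact hammingQ_hammingDist F n i _ _

end DelsarteLP

end

/-!
Let `X = F ^ n`, `q = |F|`, and let `u` be a feasible point of Delsarte's program. Put
`f x y = u t / v_t` for words `x`, `y` at distance `t`, where `v_t = (n.choose t) (q - 1) ^ t` is the
size of a sphere of radius `t`. The dual constraints say exactly that the inner products of `f` with
the projectors `E_i` are nonnegative. As the adjacency matrices are combinations of the `E_i`
(`ite_hammingDist_eq_sum_hammingE`), so is `f`, and therefore `f` is positive semidefinite
(`Feasible.kernel_quadForm_nonneg`). Moreover `f` is nonnegative, it is `1` on the diagonal and `0`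
at the distances `1, …, d - 1`, and its row sums are all equal to `U = ∑ t, u t`.

The upper bound comes from one sphere `S` of radius `w` (the centre is immaterial). On the one hand,
`f` minus `U / |X|` times the all-ones matrix is still positive semidefinite, so the sum `T` of `f`
over `S × S` is at least `U |S| ^ 2 / |X|` (`Feasible.sum_mul_sq_le`). On the other hand, replace the
letters of a word by unit vectors. Seen from the centre of gravity of `S`, the words of `S` have the
Gram matrix `D - hammingDist x y` with `D = 2 w - q w ^ 2 / ((q - 1) n)`
(`sum_sub_sphereMean_mul`). Its inner product with `f` is nonnegative, and at most
`(D - d) T + d |S|`. Hence `(d - D) U |S| ≤ d |X|` (`Feasible.sum_mul_sphereSize_le`), and the radius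
of the theorem is the largest integer up to the smaller root of `d - D = 1 / q` (`ebRadius_spec`).

The sphere of radius `0` gives `U ≤ |X|`, which makes the feasible set compact, so that the maximum is
attained. The distance distribution of a code is feasible, since the `E_i` are positive
semidefinite. The asymptotic bound follows from the estimate `|S| ≥ exp (n H (w / n)) / (n + 1)` with
the `q`-ary entropy `H`, which holds because the term of index `w` is the largest one in the binomial
expansion of `(w + (n - w)) ^ n` (`pow_add_self_le`).
-/

namespace DelsarteLP

open Finset

/-! ### Spheres, distances and projectors of the Hamming scheme -/

variable {F : Type*} [DecidableEq F] {n : ℕ}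

theorem hammingDist_le (x y : Fin n → F) : hammingDist x y ≤ n := by
  simpa using hammingDist_le_card_fintype (x := x) (y := y)

theorem prod_ite_eq_pow_hammingDist {R : Type*} [CommSemiring R] (x y : Fin n → F) (r : R) :
    ∏ l, (if x l = y l then 1 else r) = r ^ hammingDist x y := by
  rw [Finset.prod_ite, prod_const_one, one_mul, prod_const]
  rfl

theorem sum_ite_eq_hammingDist (x y : Fin n → F) (a b : ℝ) :
    ∑ l, (if x l = y l then a else b) = (n - hammingDist x y) * a + hammingDist x y * b := by
  have h : ∀ l, (if x l = y l then a else b) = a + if x l ≠ y l then b - a else 0 := by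
    intro l; by_cases h : x l = y l <;> simp [h]
  simp_rw [h]
  rw [sum_add_distrib, ← sum_filter, sum_const, sum_const]
  change _ + hammingDist x y • (b - a) = _
  simp only [card_univ, Fintype.card_fin, nsmul_eq_mul]
  ring

variable [Fintype F]

/-- The number of words at distance `t` from a given word of length `n` over an alphabet of
size `q`. -/
noncomputable def sphereSize (q n t : ℕ) : ℝ := (n.choose t : ℝ) * ((q : ℝ) - 1) ^ t

theorem sphereSize_pos {q t : ℕ} (hq : 2 ≤ q) (ht : t ≤ n) : 0 < sphereSize q n t := by
  have : (2 : ℝ) ≤ q := by exact_mod_cast hq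
  have h1 : (0 : ℝ) < n.choose t := by exact_mod_cast Nat.choose_pos ht
  have h2 : (0 : ℝ) < (q : ℝ) - 1 := by linarith
  exact mul_pos h1 (pow_pos h2 t)

theorem coeff_one_add_C_mul_X_pow (c : ℝ) (m t : ℕ) :
    ((1 + Polynomial.C c * Polynomial.X) ^ m).coeff t = (m.choose t : ℝ) * c ^ t := by
  rw [add_comm, add_pow]
  simp only [one_pow, mul_one, mul_pow, ← Polynomial.C_pow, Polynomial.finsetSum_coeff,
    ← Polynomial.C_eq_natCast, Polynomial.coeff_mul_C, Polynomial.coeff_C_mul,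
    Polynomial.coeff_X_pow]
  simp only [mul_ite, mul_one, mul_zero, ite_mul, zero_mul, Finset.sum_ite_eq, mem_range]
  split_ifs with h
  · ring
  · rw [Nat.choose_eq_zero_of_lt (by omega)]; simp

/-- The generating function `∑ y, z ^ hammingDist x y` factors over the coordinates, as
`(1 + (q - 1) z) ^ n`. -/
theorem sum_ite_hammingDist_eq (x : Fin n → F) (t : ℕ) :
    ∑ y, (if hammingDist x y = t then (1 : ℝ) else 0) = sphereSize (Fintype.card F) n t := by
  have h1 : ∑ y : Fin n → F, (Polynomial.X : Polynomial ℝ) ^ hammingDist x y =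
      (1 + Polynomial.C ((Fintype.card F : ℝ) - 1) * Polynomial.X) ^ n := by
    simp_rw [← prod_ite_eq_pow_hammingDist]
    rw [← Fintype.prod_sum (fun l a => if x l = a then (1 : Polynomial ℝ) else Polynomial.X)]
    have h2 : ∀ l, ∑ a, (if x l = a then (1 : Polynomial ℝ) else Polynomial.X) =
        1 + Polynomial.C ((Fintype.card F : ℝ) - 1) * Polynomial.X := by
      intro l
      have h : ∀ a, (if x l = a then (1 : Polynomial ℝ) else Polynomial.X) =
          (if x l = a then 1 - Polynomial.X else 0) + Polynomial.X := by
        intro a; split_ifs <;> ring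
      simp_rw [h]
      simp [sum_add_distrib]
      ring
    simp_rw [h2]
    simp
  have h3 := congrArg (fun p => Polynomial.coeff p t) h1
  simp only [Polynomial.finsetSum_coeff, Polynomial.coeff_X_pow, coeff_one_add_C_mul_X_pow] at h3
  rw [sphereSize, ← h3]
  exact sum_congr rfl fun y _ => by simp [eq_comm]

/-- Summation over the spheres around `x`. -/
theorem sum_comp_hammingDist (x : Fin n → F) (φ : ℕ → ℝ) :
    ∑ y, φ (hammingDist x y) =
      ∑ t : Fin (n + 1), sphereSize (Fintype.card F) n t * φ t := by
  simp_rw [← sum_ite_hammingDist_eq x, sum_mul]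
  rw [sum_comm]
  refine sum_congr rfl fun y _ => ?_
  rw [sum_eq_single (⟨hammingDist x y, Nat.lt_succ_of_le (hammingDist_le x y)⟩ : Fin (n + 1))]
  · simp
  · intro t _ ht
    rw [if_neg (fun h => ht (Fin.ext h.symm)), zero_mul]
  · simp

/-- The adjacency matrices of the Hamming scheme are combinations of its projectors: both sides
are the coefficient of `z ^ t` in
`z ^ hammingDist x y = ∏ₗ ((1 - z) (I - J / q) + (1 + (q - 1) z) (J / q)) (x l) (y l)`. -/
theorem ite_hammingDist_eq_sum_hammingE [Nonempty F] (x y : Fin n → F) (t : ℕ) :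
    (if hammingDist x y = t then (1 : ℝ) else 0) = ∑ i ∈ range (n + 1),
      ((1 - Polynomial.X) ^ i *
        (1 + Polynomial.C ((Fintype.card F : ℝ) - 1) * Polynomial.X) ^ (n - i)).coeff t *
        hammingE F n i x y := by
  have hq : (Fintype.card F : ℝ) ≠ 0 := by exact_mod_cast Fintype.card_ne_zero
  set q : ℝ := (Fintype.card F : ℝ) with hqd
  set A : Polynomial ℝ := 1 - Polynomial.X with hA
  set B : Polynomial ℝ := 1 + Polynomial.C (q - 1) * Polynomial.X with hB
  have h1 : ∀ l, (if x l = y l then (1 : Polynomial ℝ) else Polynomial.X) =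
      Polynomial.C ((if x l = y l then (1 : ℝ) else 0) - 1 / q) * A + Polynomial.C (1 / q) * B := by
    intro l
    have hc : Polynomial.C (1 / q) * Polynomial.C q = 1 := by
      rw [← Polynomial.C_mul, one_div_mul_cancel hq, Polynomial.C_1]
    by_cases h : x l = y l
    · simp only [h, if_true, hA, hB, Polynomial.C_sub, Polynomial.C_1]
      linear_combination (-Polynomial.X) * hc
    · simp only [h, if_false, hA, hB, Polynomial.C_sub, Polynomial.C_1, Polynomial.C_0]
      linear_combination (-Polynomial.X) * hc
  have h2 : (Polynomial.X : Polynomial ℝ) ^ hammingDist x y = ∑ S : Finset (Fin n),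
      Polynomial.C (∏ l, if l ∈ S then ((if x l = y l then 1 else 0) - 1 / q) else 1 / q) *
        (A ^ S.card * B ^ (n - S.card)) := by
    rw [← prod_ite_eq_pow_hammingDist]
    simp_rw [h1]
    rw [Fintype.prod_add]
    refine sum_congr rfl fun S _ => ?_
    have h : (∏ l, if l ∈ S then ((if x l = y l then (1 : ℝ) else 0) - 1 / q) else 1 / q) =
        (∏ l ∈ S, ((if x l = y l then (1 : ℝ) else 0) - 1 / q)) * ∏ l ∈ Sᶜ, 1 / q := by
      rw [← prod_mul_prod_compl S]
      congr 1
      · exact prod_congr rfl fun l hl => if_pos hl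
      · exact prod_congr rfl fun l hl => if_neg (by simpa using hl)
    simp only [h, prod_mul_distrib, prod_const, card_compl, Fintype.card_fin, Polynomial.C_mul,
      map_prod, map_pow]
    ring
  have h3 := congrArg (fun p => Polynomial.coeff p t) h2
  simp only [Polynomial.finsetSum_coeff, Polynomial.coeff_X_pow, Polynomial.coeff_C_mul] at h3
  rw [show (if hammingDist x y = t then (1 : ℝ) else 0) =
    if t = hammingDist x y then (1 : ℝ) else 0 by simp [eq_comm], h3]
  have h4 := Finset.sum_powerset (univ : Finset (Fin n)) (fun S =>
    (∏ l, if l ∈ S then ((if x l = y l then 1 else 0) - 1 / q) else 1 / q) *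
        (A ^ S.card * B ^ (n - S.card)).coeff t)
  rw [powerset_univ, card_univ, Fintype.card_fin] at h4
  rw [h4]
  refine sum_congr rfl fun i _ => ?_
  simp only [hammingE, Matrix.of_apply, mul_sum]
  refine sum_congr rfl fun S hS => ?_
  rw [(mem_powersetCard.mp hS).2, mul_comm]

theorem hammingE_comm (i : ℕ) (x y : Fin n → F) : hammingE F n i x y = hammingE F n i y x := by
  simp only [hammingE, Matrix.of_apply, eq_comm]

theorem sum_hammingE_mul_hammingE [Nonempty F] (i j : ℕ) (x y : Fin n → F) :
    ∑ z, hammingE F n i x z * hammingE F n j z y =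
      if i = j then hammingE F n i x y else 0 := by
  rw [← Matrix.mul_apply, hammingE_mul]
  split_ifs <;> simp

/-- The projectors are positive semidefinite, as `E_i = E_i E_iᵀ`. -/
theorem hammingE_quadForm_nonneg [Nonempty F] (i : ℕ) (s : (Fin n → F) → ℝ) :
    0 ≤ ∑ x, ∑ y, hammingE F n i x y * s x * s y := by
  have h : ∑ x, ∑ y, hammingE F n i x y * s x * s y =
      ∑ z, (∑ x, hammingE F n i z x * s x) ^ 2 := by
    simp_rw [sq, sum_mul_sum]
    rw [sum_comm (s := (univ : Finset (Fin n → F)))]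
    conv_rhs => rw [sum_comm]
    rw [sum_comm]
    refine sum_congr rfl fun x _ => ?_
    conv_rhs => rw [sum_comm]
    refine sum_congr rfl fun y _ => ?_
    have := sum_hammingE_mul_hammingE i i x y
    rw [if_pos rfl] at this
    rw [← this, sum_mul, sum_mul]
    refine sum_congr rfl fun z _ => ?_
    rw [hammingE_comm i x z]; ring
  rw [h]
  exact sum_nonneg fun _ _ => sq_nonneg _

theorem krawtchouk_zero_right (q k : ℕ) : krawtchouk q n k 0 = sphereSize q n k := by
  rw [krawtchouk, sum_eq_single 0]
  · simp [sphereSize, mul_comm]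
  · intro s _ hs
    rw [Nat.choose_eq_zero_of_lt (Nat.pos_of_ne_zero hs)]; simp
  · simp

/-! ### Feasible points as positive semidefinite kernels -/

/-- The invariant kernel on `F ^ n` with the distance distribution `u`: the entry at a pair of words
at distance `t` is `u t` divided by the number of words at distance `t` from a given one. -/
noncomputable def kernel (F : Type*) [Fintype F] [DecidableEq F] (u : Fin (n + 1) → ℝ)
    (x y : Fin n → F) : ℝ :=
  u ⟨hammingDist x y, Nat.lt_succ_of_le (hammingDist_le x y)⟩ /
    sphereSize (Fintype.card F) n (hammingDist x y)

theorem kernel_comm (u : Fin (n + 1) → ℝ) (x y : Fin n → F) :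
    kernel F u x y = kernel F u y x := by
  simp only [kernel, hammingDist_comm]

theorem kernel_self (u : Fin (n + 1) → ℝ) (x : Fin n → F) : kernel F u x x = u 0 := by
  simp [kernel, sphereSize]

/-- Collecting the entries of a row by distance cancels the sphere sizes, whatever the row. -/
theorem sum_kernel_mul (hF : 2 ≤ Fintype.card F) (u : Fin (n + 1) → ℝ) (φ : ℕ → ℝ)
    (x : Fin n → F) :
    ∑ y, kernel F u x y * φ (hammingDist x y) = ∑ t : Fin (n + 1), u t * φ t := by
  have h := sum_comp_hammingDist x (fun t => if h : t < n + 1 then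
    u ⟨t, h⟩ / sphereSize (Fintype.card F) n t * φ t else 0)
  have h1 : ∀ y, kernel F u x y * φ (hammingDist x y) = if h : hammingDist x y < n + 1 then
    u ⟨hammingDist x y, h⟩ / sphereSize (Fintype.card F) n (hammingDist x y) *
      φ (hammingDist x y) else 0 := by
    intro y
    rw [dif_pos (Nat.lt_succ_of_le (hammingDist_le x y)), kernel]
  simp_rw [h1]
  rw [h]
  refine sum_congr rfl fun t _ => ?_
  rw [dif_pos t.2]
  have := (sphereSize_pos hF (Nat.le_of_lt_succ t.2)).ne'
  field_simp

theorem sum_kernel (hF : 2 ≤ Fintype.card F) (u : Fin (n + 1) → ℝ) (x : Fin n → F) :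
    ∑ y, kernel F u x y = ∑ t, u t := by
  simpa using sum_kernel_mul hF u (fun _ => 1) x

theorem exists_kernel_eq_sum_hammingE [Nonempty F] (u : Fin (n + 1) → ℝ) :
    ∃ c : ℕ → ℝ, ∀ x y, kernel F u x y = ∑ i ∈ range (n + 1), c i * hammingE F n i x y := by
  refine ⟨fun i => ∑ t : Fin (n + 1), u t / sphereSize (Fintype.card F) n t *
    ((1 - Polynomial.X) ^ i *
      (1 + Polynomial.C ((Fintype.card F : ℝ) - 1) * Polynomial.X) ^ (n - i)).coeff t,
    fun x y => ?_⟩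
  simp_rw [sum_mul, mul_assoc]
  rw [sum_comm]
  simp_rw [← mul_sum, ← ite_hammingDist_eq_sum_hammingE]
  rw [sum_eq_single (⟨hammingDist x y, Nat.lt_succ_of_le (hammingDist_le x y)⟩ : Fin (n + 1))]
  · simp [kernel]
  · intro t _ ht
    rw [if_neg (fun h => ht (Fin.ext h.symm)), mul_zero]
  · simp

/-- The kernel of a feasible point is positive semidefinite: its eigenvalue on the range of `E_i`
is, up to the positive factor `tr E_i`, its inner product with `E_i`, which is the left-hand side
of the `i`-th dual constraint. -/
theorem Feasible.kernel_quadForm_nonneg (hF : 2 ≤ Fintype.card F) {d : ℕ} {u : Fin (n + 1) → ℝ}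
    (hu : Feasible n d (hammingQ F n) u) (s : (Fin n → F) → ℝ) :
    0 ≤ ∑ x, ∑ y, kernel F u x y * s x * s y := by
  have : Nontrivial F := Fintype.one_lt_card_iff_nontrivial.mp hF
  have hX : (0 : ℝ) < Fintype.card (Fin n → F) := by exact_mod_cast Fintype.card_pos
  obtain ⟨c, hc⟩ := exists_kernel_eq_sum_hammingE (F := F) u
  have hc0 : ∀ i ∈ range (n + 1), 0 ≤ c i := by
    intro i hi
    have hin : i < n + 1 := mem_range.mp hi
    have h1 : ∑ x, ∑ y, kernel F u x y * hammingE F n i y x =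
        c i * sphereSize (Fintype.card F) n i := by
      have h2 : ∀ x, ∑ y, kernel F u x y * hammingE F n i y x = c i * hammingE F n i x x := by
        intro x
        simp_rw [hc, sum_mul]
        rw [sum_comm]
        simp_rw [mul_assoc, ← mul_sum, sum_hammingE_mul_hammingE]
        rw [sum_eq_single i (fun j _ hj => by simp [hj]) (fun h => absurd hi h), if_pos rfl]
      simp_rw [h2, hammingE_apply, hammingDist_self, krawtchouk_zero_right]
      rw [sum_const, card_univ, nsmul_eq_mul]
      field_simp
    have h3 : ∑ x, ∑ y, kernel F u x y * hammingE F n i y x =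
        ∑ t : Fin (n + 1), u t * hammingQ F n i t := by
      have h2 : ∀ x, ∑ y, kernel F u x y * hammingE F n i y x =
          1 / (Fintype.card (Fin n → F) : ℝ) * ∑ t : Fin (n + 1), u t * hammingQ F n i t := by
        intro x
        rw [← sum_kernel_mul hF u (hammingQ F n i) x, mul_sum]
        refine sum_congr rfl fun y _ => ?_
        rw [hammingE_comm, hammingE_apply, hammingQ_hammingDist]; ring
      simp_rw [h2]
      rw [sum_const, card_univ, nsmul_eq_mul]
      field_simp
    have h4 := hu.dual ⟨i, hin⟩
    rw [← h3, h1] at h4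
    exact nonneg_of_mul_nonneg_left h4 (sphereSize_pos hF (Nat.le_of_lt_succ hin))
  have h5 : ∑ x, ∑ y, kernel F u x y * s x * s y =
      ∑ i ∈ range (n + 1), c i * ∑ x, ∑ y, hammingE F n i x y * s x * s y := by
    simp_rw [hc, sum_mul, mul_sum]
    rw [sum_comm (s := range (n + 1))]
    refine sum_congr rfl fun x _ => ?_
    rw [sum_comm]
    exact sum_congr rfl fun i _ => sum_congr rfl fun y _ => by ring
  rw [h5]
  exact sum_nonneg fun i hi => mul_nonneg (hc0 i hi) (hammingE_quadForm_nonneg i s)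

theorem Feasible.nonneg' {d : ℕ} {Q : ℕ → ℕ → ℝ} {u : Fin (n + 1) → ℝ} (hu : Feasible n d Q u)
    (t : Fin (n + 1)) : 0 ≤ u t := by
  by_cases h : d ≤ t
  · exact hu.nonneg t h
  · by_cases h0 : t = 0
    · rw [h0, hu.zero]; norm_num
    · rw [hu.gap t (Nat.one_le_iff_ne_zero.mpr (fun h => h0 (Fin.ext h))) (by omega)]

/-- The all-ones vector is an eigenvector of the kernel for the eigenvalue `∑ t, u t`; positivity on
the complement of the constants gives a lower bound for the quadratic form. -/
theorem Feasible.sum_mul_sq_le (hF : 2 ≤ Fintype.card F) {d : ℕ} {u : Fin (n + 1) → ℝ}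
    (hu : Feasible n d (hammingQ F n) u) (s : (Fin n → F) → ℝ) :
    (∑ t, u t) * (∑ x, s x) ^ 2 ≤
      (Fintype.card F : ℝ) ^ n * ∑ x, ∑ y, kernel F u x y * s x * s y := by
  have hX : (0 : ℝ) < (Fintype.card F : ℝ) ^ n := by positivity
  set N : ℝ := (Fintype.card F : ℝ) ^ n with hN
  set σ := ∑ x, s x with hσ
  set U := ∑ t, u t with hU
  -- Subtracting the mean of `s` projects it onto the complement of the constants.
  have h := hu.kernel_quadForm_nonneg hF (fun x => s x - σ / N)
  have e1 : ∑ x, ∑ y, kernel F u x y * s x = U * σ := by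
    simp_rw [← sum_mul, sum_kernel hF, hσ, mul_sum]; rfl
  have e2 : ∑ x, ∑ y, kernel F u x y * s y = U * σ := by
    rw [sum_comm, ← e1]
    exact sum_congr rfl fun x _ => sum_congr rfl fun y _ => by rw [kernel_comm]
  have e3 : ∑ x : Fin n → F, ∑ y, kernel F u x y = N * U := by
    simp_rw [sum_kernel hF]
    simp [hN, hU]
  have e4 : ∑ x, ∑ y, kernel F u x y * (s x - σ / N) * (s y - σ / N) =
      ∑ x, ∑ y, kernel F u x y * s x * s y - σ / N * (∑ x, ∑ y, kernel F u x y * s x)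
      - σ / N * (∑ x, ∑ y, kernel F u x y * s y) + (σ / N) ^ 2 * ∑ x, ∑ y, kernel F u x y := by
    simp_rw [mul_sum, ← sum_sub_distrib, ← sum_add_distrib]
    exact sum_congr rfl fun x _ => sum_congr rfl fun y _ => by ring
  rw [e4, e1, e2, e3] at h
  have h6 := mul_nonneg hX.le h
  have : N * (∑ x, ∑ y, kernel F u x y * s x * s y - σ / N * (U * σ) - σ / N * (U * σ) +
      (σ / N) ^ 2 * (N * U)) = N * ∑ x, ∑ y, kernel F u x y * s x * s y - U * σ ^ 2 := by
    field_simp; ring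
  linarith

/-! ### The bound from a sphere -/

/-- When the letters of words are replaced by unit vectors, this is the component of a letter, at a
given coordinate, in the centre of gravity of a sphere of radius `w`: the proportion of the words of
the sphere that have this letter there. The proposition `p` says that the letter is that of the
centre of the sphere. -/
noncomputable def sphereMean (q n w : ℕ) (p : Prop) [Decidable p] : ℝ :=
  if p then 1 - (w : ℝ) / n else w / n / ((q : ℝ) - 1)

/-- Replace each letter of a word by its unit vector in `ℝ ^ F`. On the sphere of radius `w` around
`z`, the Gram matrix of the resulting vectors, taken with respect to their centre of gravity, is an
affine function of the distance. -/
theorem sum_sub_sphereMean_mul (hF : 2 ≤ Fintype.card F) (hn : 0 < n) {w : ℕ}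
    {x y z : Fin n → F} (hx : hammingDist x z = w) (hy : hammingDist y z = w) :
    ∑ l, ∑ a, ((if x l = a then 1 else 0) - sphereMean (Fintype.card F) n w (a = z l)) *
      ((if y l = a then 1 else 0) - sphereMean (Fintype.card F) n w (a = z l)) =
    2 * w - Fintype.card F * (w : ℝ) ^ 2 / (((Fintype.card F : ℝ) - 1) * n) -
      hammingDist x y := by
  have hq : (2 : ℝ) ≤ Fintype.card F := by exact_mod_cast hF
  set q := Fintype.card F with hqd
  have hq1 : (q : ℝ) - 1 ≠ 0 := by linarith
  have hn0 : (n : ℝ) ≠ 0 := by exact_mod_cast hn.ne'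
  have h1 : ∀ l, ∑ a, sphereMean q n w (a = z l) ^ 2 =
      (1 - (w : ℝ) / n) ^ 2 + (w / n) ^ 2 / ((q : ℝ) - 1) := by
    intro l
    have h : ∀ a, sphereMean q n w (a = z l) ^ 2 = (if a = z l then
        (1 - (w : ℝ) / n) ^ 2 - (w / n / ((q : ℝ) - 1)) ^ 2 else 0) +
        (w / n / ((q : ℝ) - 1)) ^ 2 := by
      intro a; by_cases h : a = z l <;> simp [sphereMean, h]
    simp_rw [h]
    rw [sum_add_distrib, sum_ite_eq' univ (z l), if_pos (mem_univ _), sum_const, card_univ,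
      nsmul_eq_mul, ← hqd]
    field_simp
    ring
  have h2 : ∀ l, ∑ a, ((if x l = a then (1 : ℝ) else 0) - sphereMean q n w (a = z l)) *
      ((if y l = a then 1 else 0) - sphereMean q n w (a = z l)) =
      (if x l = y l then (1 : ℝ) else 0) - sphereMean q n w (x l = z l) -
        sphereMean q n w (y l = z l) +
        ((1 - (w : ℝ) / n) ^ 2 + (w / n) ^ 2 / ((q : ℝ) - 1)) := by
    intro l
    have h : ∀ a, ((if x l = a then (1 : ℝ) else 0) - sphereMean q n w (a = z l)) *
      ((if y l = a then 1 else 0) - sphereMean q n w (a = z l)) =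
      (if y l = a then (if x l = a then (1 : ℝ) else 0) else 0) -
      (if x l = a then sphereMean q n w (a = z l) else 0) -
      (if y l = a then sphereMean q n w (a = z l) else 0) +
      sphereMean q n w (a = z l) ^ 2 := by
      intro a; split_ifs <;> ring
    simp_rw [h]
    rw [sum_add_distrib, sum_sub_distrib, sum_sub_distrib, h1]
    simp only [sum_ite_eq, mem_univ, if_true]
  simp_rw [h2]
  rw [sum_add_distrib, sum_sub_distrib, sum_sub_distrib]
  simp only [sphereMean]
  rw [sum_ite_eq_hammingDist, sum_ite_eq_hammingDist, sum_ite_eq_hammingDist, hx, hy, sum_const,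
    card_univ, Fintype.card_fin, nsmul_eq_mul]
  field_simp
  ring

/-- Restrict the kernel to a sphere of radius `w` and pair it with the Gram matrix of
`sum_sub_sphereMean_mul`. The result is nonnegative, while the entries of the Gram matrix at
distance at least `d` are at most `0`, so that the diagonal has to carry a definite part of the sum
of the kernel over the sphere. -/
theorem Feasible.sum_mul_sphereSize_le (hF : 2 ≤ Fintype.card F) (hn : 0 < n) {d w : ℕ}
    {u : Fin (n + 1) → ℝ} (hu : Feasible n d (hammingQ F n) u) (hw : w ≤ n)
    (hd : (2 * w - Fintype.card F * (w : ℝ) ^ 2 / (((Fintype.card F : ℝ) - 1) * n)) ≤ d) :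
    (d - (2 * w - Fintype.card F * (w : ℝ) ^ 2 / (((Fintype.card F : ℝ) - 1) * n))) *
      ((∑ t, u t) * sphereSize (Fintype.card F) n w) ≤ d * (Fintype.card F : ℝ) ^ n := by
  have : Nontrivial F := Fintype.one_lt_card_iff_nontrivial.mp hF
  -- Any word serves as the centre of the sphere; `s` is the indicator function of the sphere.
  obtain ⟨z⟩ : Nonempty (Fin n → F) := inferInstance
  set D : ℝ := 2 * w - Fintype.card F * (w : ℝ) ^ 2 / (((Fintype.card F : ℝ) - 1) * n) with hD
  set σ := sphereSize (Fintype.card F) n w with hσd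
  have hσ0 : 0 < σ := sphereSize_pos hF hw
  set s : (Fin n → F) → ℝ := fun x => if hammingDist x z = w then 1 else 0 with hs
  have hss : ∀ x, s x * s x = s x := fun x => by simp [hs]
  have hs0 : ∀ x, 0 ≤ s x := fun x => by simp only [hs]; split_ifs <;> norm_num
  have hσ : ∑ x, s x = σ := by
    rw [hσd, ← sum_ite_hammingDist_eq z]
    exact sum_congr rfl fun x _ => by rw [hammingDist_comm]
  have hk0 : ∀ x y, 0 ≤ kernel F u x y := fun x y =>
    div_nonneg (hu.nonneg' _) (sphereSize_pos hF (hammingDist_le x y)).le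
  set T := ∑ x, ∑ y, kernel F u x y * s x * s y with hT
  have hlow := hu.sum_mul_sq_le hF s
  rw [hσ, ← hT] at hlow
  have hgram : 0 ≤ ∑ x, ∑ y, kernel F u x y * s x * s y * (D - hammingDist x y) := by
    set φ : Fin n × F → (Fin n → F) → ℝ := fun p x =>
      s x * ((if x p.1 = p.2 then 1 else 0) - sphereMean (Fintype.card F) n w (p.2 = z p.1)) with hφ
    have h' : ∀ x y, kernel F u x y * s x * s y * (D - hammingDist x y) =
        ∑ p, kernel F u x y * φ p x * φ p y := by
      intro x y
      by_cases hx : hammingDist x z = w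
      · by_cases hy : hammingDist y z = w
        · rw [hD, ← sum_sub_sphereMean_mul hF hn hx hy, ← Fintype.sum_prod_type', mul_sum]
          exact sum_congr rfl fun p _ => by simp only [hφ]; ring
        · simp [hφ, hs, hy]
      · simp [hφ, hs, hx]
    have h : ∑ x, ∑ y, kernel F u x y * s x * s y * (D - hammingDist x y) =
        ∑ p, ∑ x, ∑ y, kernel F u x y * φ p x * φ p y := by
      simp_rw [h']
      conv_rhs => rw [sum_comm]
      refine sum_congr rfl fun x _ => ?_
      rw [sum_comm]
    rw [h]
    exact sum_nonneg fun p _ => hu.kernel_quadForm_nonneg hF _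
  have hup : ∑ x, ∑ y, kernel F u x y * s x * s y * (D - hammingDist x y) ≤
      (D - d) * T + d * σ := by
    rw [hT, ← hσ, mul_sum, mul_sum, ← sum_add_distrib]
    refine sum_le_sum fun x _ => ?_
    have hdiag : (d : ℝ) * s x = ∑ y, if x = y then (d : ℝ) * s x else 0 := by simp
    rw [hdiag, mul_sum, ← sum_add_distrib]
    refine sum_le_sum fun y _ => ?_
    have hnn : 0 ≤ kernel F u x y * s x * s y := mul_nonneg (mul_nonneg (hk0 x y) (hs0 x)) (hs0 y)
    by_cases hxy : x = y
    · subst hxy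
      rw [kernel_self, hu.zero, if_pos rfl, hammingDist_self, one_mul, hss]
      simp only [Nat.cast_zero]
      linarith
    · rw [if_neg hxy, add_zero]
      have hpos : 0 < hammingDist x y := hammingDist_pos.mpr hxy
      by_cases hlt : hammingDist x y < d
      · have : kernel F u x y = 0 := by
          rw [kernel, hu.gap ⟨hammingDist x y, _⟩ hpos hlt, zero_div]
        simp [this]
      · have : (d : ℝ) ≤ hammingDist x y := by exact_mod_cast not_lt.mp hlt
        nlinarith
  have hTσ : (d - D) * T ≤ d * σ := by linarith
  have hN : (0 : ℝ) ≤ (Fintype.card F : ℝ) ^ n := by positivity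
  have h1 : (d - D) * ((∑ t, u t) * σ ^ 2) ≤ (Fintype.card F : ℝ) ^ n * (d * σ) :=
    calc (d - D) * ((∑ t, u t) * σ ^ 2) ≤ (d - D) * ((Fintype.card F : ℝ) ^ n * T) :=
          mul_le_mul_of_nonneg_left hlow (by linarith)
      _ = (Fintype.card F : ℝ) ^ n * ((d - D) * T) := by ring
      _ ≤ _ := mul_le_mul_of_nonneg_left hTσ hN
  refine le_of_mul_le_mul_right ?_ hσ0
  calc _ = (d - D) * ((∑ t, u t) * σ ^ 2) := by ring
    _ ≤ _ := h1
    _ = _ := by ring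

/-- The sphere of radius `0` shows that the program is bounded by the size of the space. -/
theorem Feasible.sum_le (hF : 2 ≤ Fintype.card F) {d : ℕ} {u : Fin (n + 1) → ℝ}
    (hu : Feasible n d (hammingQ F n) u) : ∑ t, u t ≤ (Fintype.card F : ℝ) ^ n := by
  have : Nontrivial F := Fintype.one_lt_card_iff_nontrivial.mp hF
  obtain ⟨z⟩ : Nonempty (Fin n → F) := inferInstance
  have h := hu.sum_mul_sq_le hF (fun x => if x = z then 1 else 0)
  simpa [kernel_self, hu.zero] using h

/-! ### The maximum is attained, and bounds the size of codes -/

/-- The distance distribution of a code with one word is feasible for every `d`. -/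
theorem feasible_single (hF : 2 ≤ Fintype.card F) (d : ℕ) :
    Feasible n d (hammingQ F n) (Pi.single 0 1) := by
  have : Nontrivial F := Fintype.one_lt_card_iff_nontrivial.mp hF
  refine ⟨by simp, fun t ht _ => ?_, fun t _ => ?_, fun i => ?_⟩
  · have : t ≠ 0 := by rintro rfl; simp at ht
    simp [this]
  · by_cases h : t = 0 <;> simp [h]
  · rw [sum_eq_single 0]
    · rw [Pi.single_eq_same, one_mul, Fin.val_zero, hammingQ_eq_krawtchouk F n i 0 (Nat.zero_le _),
        krawtchouk_zero_right]
      exact (sphereSize_pos hF (Nat.le_of_lt_succ i.2)).le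
    · intro t _ ht; simp [ht]
    · simp

theorem isGreatest_hammingALP (hF : 2 ≤ Fintype.card F) (n d : ℕ) :
    IsGreatest (lpValues n d (hammingQ F n)) (hammingALP F n d) := by
  set P : Set (Fin (n + 1) → ℝ) := {u | Feasible n d (hammingQ F n) u} with hP
  have himage : lpValues n d (hammingQ F n) = (fun u => ∑ t, u t) '' P := by
    ext s
    simp only [lpValues, hP, Set.mem_image, Set.mem_ofPred_eq, eq_comm]
  have hclosed : IsClosed P := by
    have : P = {u | u 0 = 1} ∩
        (⋂ t : Fin (n + 1), ⋂ (_ : 1 ≤ (t : ℕ)), ⋂ (_ : (t : ℕ) < d), {u | u t = 0}) ∩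
        (⋂ t : Fin (n + 1), ⋂ (_ : d ≤ (t : ℕ)), {u | 0 ≤ u t}) ∩
        ⋂ i : Fin (n + 1), {u | 0 ≤ ∑ t : Fin (n + 1), u t * hammingQ F n i t} := by
      ext u
      simp only [hP, Set.mem_ofPred_eq, Set.mem_inter_iff, Set.mem_iInter]
      exact ⟨fun h => ⟨⟨⟨h.1, h.2⟩, h.3⟩, h.4⟩, fun h => ⟨h.1.1.1, h.1.1.2, h.1.2, h.2⟩⟩
    rw [this]
    refine ((IsClosed.inter ?_ ?_).inter ?_).inter ?_
    · exact isClosed_eq (by fun_prop) (by fun_prop)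
    · exact isClosed_iInter fun t => isClosed_iInter fun _ => isClosed_iInter fun _ =>
        isClosed_eq (by fun_prop) (by fun_prop)
    · exact isClosed_iInter fun t => isClosed_iInter fun _ =>
        isClosed_le (by fun_prop) (by fun_prop)
    · exact isClosed_iInter fun i => isClosed_le (by fun_prop) (by fun_prop)
  have hsub : P ⊆ Set.Icc (fun _ => 0) (fun _ => (Fintype.card F : ℝ) ^ n) := by
    intro u hu
    have hu' : Feasible n d (hammingQ F n) u := hu
    exact ⟨hu'.nonneg', fun t =>
      (single_le_sum (fun t _ => hu'.nonneg' t) (mem_univ t)).trans (hu'.sum_le hF)⟩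
  have hcompact : IsCompact P := isCompact_Icc.of_isClosed_subset hclosed hsub
  rw [hammingALP, himage]
  exact (hcompact.image (by fun_prop)).isGreatest_sSup ⟨_, _, feasible_single hF d, rfl⟩

theorem one_le_hammingALP (hF : 2 ≤ Fintype.card F) (n d : ℕ) : 1 ≤ hammingALP F n d :=
  (isGreatest_hammingALP hF n d).2 ⟨_, feasible_single hF d, by simp⟩

/-- The distance distribution of a code is a feasible point; the dual constraints express that the
projectors `E_i` are positive semidefinite. -/
theorem card_le_hammingALP (hF : 2 ≤ Fintype.card F) {d : ℕ} {C : Finset (Fin n → F)}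
    (hC : MinDistGE C d) : (#C : ℝ) ≤ hammingALP F n d := by
  have : Nontrivial F := Fintype.one_lt_card_iff_nontrivial.mp hF
  rcases C.eq_empty_or_nonempty with rfl | hne
  · simpa using zero_le_one.trans (one_le_hammingALP hF n d)
  have hc : (0 : ℝ) < #C := by exact_mod_cast hne.card_pos
  set u : Fin (n + 1) → ℝ := fun t =>
    1 / (#C : ℝ) * ∑ x ∈ C, ∑ y ∈ C, if hammingDist x y = t then 1 else 0 with hu
  have hsum : ∀ φ : ℕ → ℝ, ∑ t : Fin (n + 1), u t * φ t =
      1 / (#C : ℝ) * ∑ x ∈ C, ∑ y ∈ C, φ (hammingDist x y) := by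
    intro φ
    simp_rw [hu, mul_assoc, ← mul_sum, sum_mul]
    congr 1
    rw [sum_comm]
    refine sum_congr rfl fun x _ => ?_
    rw [sum_comm]
    refine sum_congr rfl fun y _ => ?_
    rw [sum_eq_single (⟨hammingDist x y, Nat.lt_succ_of_le (hammingDist_le x y)⟩ : Fin (n + 1))]
    · simp
    · intro t _ ht
      rw [if_neg (fun h => ht (Fin.ext h.symm)), zero_mul]
    · simp
  have h0 : ∀ t, 0 ≤ u t := fun t => mul_nonneg (by positivity)
    (sum_nonneg fun x _ => sum_nonneg fun y _ => by split_ifs <;> norm_num)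
  refine (isGreatest_hammingALP hF n d).2 ⟨u, ⟨?_, fun t ht htd => ?_, fun t _ => h0 t,
    fun i => ?_⟩, ?_⟩
  · have : ∀ x ∈ C, ∑ y ∈ C, (if hammingDist x y = 0 then (1 : ℝ) else 0) = 1 := by
      intro x hx
      simp [hx]
    change 1 / (#C : ℝ) * (∑ x ∈ C, ∑ y ∈ C, if hammingDist x y = 0 then (1 : ℝ) else 0) = 1
    rw [sum_congr rfl this]
    simp [hc.ne']
  · simp only [hu]
    rw [sum_eq_zero, mul_zero]
    refine fun x hx => sum_eq_zero fun y hy => if_neg fun hxy => ?_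
    have hne : x ≠ y := hammingDist_pos.mp (by omega)
    exact absurd (hC x hx y hy hne) (by omega)
  · rw [hsum (hammingQ F n i)]
    have hE := hammingE_quadForm_nonneg (n := n) (i : ℕ)
      (fun x : Fin n → F => if x ∈ C then 1 else 0)
    have hX : (Fintype.card (Fin n → F) : ℝ) ≠ 0 := by exact_mod_cast Fintype.card_ne_zero
    have hind : ∀ g : (Fin n → F) → (Fin n → F) → ℝ,
        ∑ x, ∑ y, g x y * (if x ∈ C then 1 else 0) * (if y ∈ C then 1 else 0) =
          ∑ x ∈ C, ∑ y ∈ C, g x y := by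
      intro g
      rw [← sum_subset (subset_univ C) (fun x _ hx => by simp [hx])]
      refine sum_congr rfl fun x hx => ?_
      rw [← sum_subset (subset_univ C) (fun y _ hy => by simp [hy])]
      exact sum_congr rfl fun y hy => by simp [hx, hy]
    rw [hind fun x y => hammingE F n i x y] at hE
    have : ∑ x ∈ C, ∑ y ∈ C, hammingQ F n i (hammingDist x y) =
        Fintype.card (Fin n → F) * ∑ x ∈ C, ∑ y ∈ C, hammingE F n i x y := by
      simp_rw [mul_sum, hammingE_apply, hammingQ_hammingDist]
      exact sum_congr rfl fun x _ => sum_congr rfl fun y _ => by field_simp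
    rw [this]
    positivity
  · have := hsum (fun _ => 1)
    simp only [mul_one] at this
    rw [this]
    simp
    field_simp

theorem maxCodeSize_le_hammingALP (hF : 2 ≤ Fintype.card F) (n d : ℕ) :
    (maxCodeSize F n d : ℝ) ≤ hammingALP F n d := by
  classical
  obtain ⟨C, hC, hsup⟩ := exists_mem_eq_sup
    ((univ : Finset (Finset (Fin n → F))).filter fun C => MinDistGE C d)
    ⟨∅, mem_filter.mpr ⟨mem_univ _, by simp [MinDistGE]⟩⟩ card
  have h := card_le_hammingALP hF (mem_filter.mp hC).2
  rw [← hsup] at h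
  rw [maxCodeSize]
  convert h

theorem one_le_maxCodeSize (hF : 2 ≤ Fintype.card F) (n d : ℕ) : 1 ≤ maxCodeSize F n d := by
  classical
  have : Nontrivial F := Fintype.one_lt_card_iff_nontrivial.mp hF
  obtain ⟨z⟩ : Nonempty (Fin n → F) := inferInstance
  rw [← card_singleton z]
  exact le_sup (f := card) (mem_filter.mpr ⟨mem_univ _, by simp [MinDistGE]⟩)

/-! ### The radius -/

/-- The radius is at most the smaller root of `d - (2 w - q w ^ 2 / ((q - 1) n)) = 1 / q`, a quadratic
equation in `w`. The hypothesis `d ≤ n (q - 1) / q` makes its discriminant nonnegative. -/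
theorem ebRadius_spec {q n d : ℕ} (hq : 2 ≤ q) (hn : 0 < n) (hd : 1 ≤ d)
    (hdn : (d : ℝ) ≤ (n : ℝ) * ((q : ℝ) - 1) / q) :
    ebRadius q n d ≤ n ∧ 1 / (q : ℝ) ≤ d - (2 * ebRadius q n d -
      q * (ebRadius q n d : ℝ) ^ 2 / (((q : ℝ) - 1) * n)) := by
  have hq2 : (2 : ℝ) ≤ q := by exact_mod_cast hq
  have hn0 : (0 : ℝ) < n := by exact_mod_cast hn
  have hd1 : (1 : ℝ) ≤ d := by exact_mod_cast hd
  have hq1 : (0 : ℝ) < (q : ℝ) - 1 := by linarith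
  have hq0 : (0 : ℝ) < q := by linarith
  set r : ℝ := Real.sqrt (1 - ((q : ℝ) * d - 1) / (((q : ℝ) - 1) * n)) with hr
  have hdn' : (q : ℝ) * d ≤ n * ((q : ℝ) - 1) := by
    rw [le_div_iff₀ hq0] at hdn; linarith
  have harg : 0 ≤ 1 - ((q : ℝ) * d - 1) / (((q : ℝ) - 1) * n) := by
    rw [sub_nonneg, div_le_one (by positivity)]; linarith
  have hr2 : r ^ 2 = 1 - ((q : ℝ) * d - 1) / (((q : ℝ) - 1) * n) := Real.sq_sqrt harg
  have hr0 : 0 ≤ r := Real.sqrt_nonneg _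
  have hr1 : r ≤ 1 := by
    rw [hr, Real.sqrt_le_one]
    have : 0 ≤ ((q : ℝ) * d - 1) / (((q : ℝ) - 1) * n) := by
      apply div_nonneg _ (by positivity); nlinarith
    linarith
  have hA : 0 < (n : ℝ) * (((q : ℝ) - 1) / q) := by positivity
  have hfl : (ebRadius q n d : ℝ) ≤ (n : ℝ) * (((q : ℝ) - 1) / q) * (1 - r) :=
    Nat.floor_le (mul_nonneg hA.le (by linarith))
  set w : ℝ := (ebRadius q n d : ℝ) with hw
  set A : ℝ := (n : ℝ) * (((q : ℝ) - 1) / q) with hAd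
  have hAn : A ≤ n := by
    rw [hAd, ← mul_div_assoc, div_le_iff₀ hq0]; nlinarith
  constructor
  · have : w ≤ n := by nlinarith
    exact Nat.cast_le.mp this
  · have e : (q : ℝ) * w ^ 2 / (((q : ℝ) - 1) * n) = w ^ 2 / A := by
      rw [hAd]; field_simp
    have e2 : A * r ^ 2 = A - (d - 1 / q) := by
      rw [hr2, hAd]; field_simp
    have h1 : (A * r) ^ 2 ≤ (A - w) ^ 2 :=
      pow_le_pow_left₀ (by positivity) (by linarith) 2
    have h2 : A * (A - (d - 1 / q)) ≤ A ^ 2 - 2 * A * w + w ^ 2 := by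
      rw [← e2]; linarith
    have h3 : 0 ≤ d - 1 / q - 2 * w + w ^ 2 / A := by
      have : d - 1 / q - 2 * w + w ^ 2 / A = (A * (d - 1 / q) - 2 * A * w + w ^ 2) / A := by
        field_simp
      rw [this]
      exact div_nonneg (by linarith) hA.le
    rw [e]; linarith

theorem hammingALP_le (hF : 2 ≤ Fintype.card F) {d : ℕ} (hn : 0 < n) (hd : 1 ≤ d)
    (hdn : (d : ℝ) ≤ (n : ℝ) * ((Fintype.card F : ℝ) - 1) / Fintype.card F) :
    hammingALP F n d ≤ (Fintype.card F : ℝ) * d * ((Fintype.card F : ℝ) ^ n /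
      sphereSize (Fintype.card F) n (ebRadius (Fintype.card F) n d)) := by
  obtain ⟨hwn, hw⟩ := ebRadius_spec hF hn hd hdn
  obtain ⟨u, hu, hval⟩ := (isGreatest_hammingALP hF n d).1
  have hq0 : (0 : ℝ) < Fintype.card F := by
    have : (2 : ℝ) ≤ Fintype.card F := by exact_mod_cast hF
    linarith
  have hinv : 0 < 1 / (Fintype.card F : ℝ) := by positivity
  have h := hu.sum_mul_sphereSize_le hF hn hwn (by linarith)
  have hσ := sphereSize_pos hF hwn
  have hU : 0 ≤ (∑ t, u t) * sphereSize (Fintype.card F) n (ebRadius (Fintype.card F) n d) :=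
    mul_nonneg (sum_nonneg fun t _ => hu.nonneg' t) hσ.le
  have h1 := (mul_le_mul_of_nonneg_right hw hU).trans h
  rw [one_div, inv_mul_le_iff₀ hq0] at h1
  rw [hval, ← mul_div_assoc, le_div_iff₀ hσ]
  linarith

/-! ### The asymptotic bound -/

theorem factorial_mul_pow_le_factorial_mul_pow (k m : ℕ) :
    m.factorial * m ^ k ≤ k.factorial * m ^ m := by
  rcases le_total m k with h | h
  · calc m.factorial * m ^ k = m.factorial * m ^ (k - m) * m ^ m := by
          rw [mul_assoc, ← pow_add, Nat.sub_add_cancel h]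
      _ ≤ _ := Nat.mul_le_mul_right _ (Nat.factorial_mul_pow_sub_le_factorial h)
  · have h1 : m.factorial ≤ k.factorial * m ^ (m - k) := by
      have := Nat.factorial_mul_descFactorial (n := m) (k := m - k) (Nat.sub_le _ _)
      rw [Nat.sub_sub_self h] at this
      rw [← this]
      exact Nat.mul_le_mul_left _ (Nat.descFactorial_le_pow _ _)
    calc m.factorial * m ^ k ≤ k.factorial * m ^ (m - k) * m ^ k := Nat.mul_le_mul_right _ h1
      _ = _ := by rw [mul_assoc, ← pow_add, Nat.sub_add_cancel h]

/-- In the binomial expansion of `(a + b) ^ (a + b)`, the term of index `a` is the largest of the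
`a + b + 1` terms. -/
theorem pow_add_self_le (a b : ℕ) :
    (a + b) ^ (a + b) ≤ (a + b + 1) * ((a + b).choose a * (a ^ a * b ^ b)) := by
  have hterm : ∀ k ∈ range (a + b + 1), a ^ k * b ^ (a + b - k) * (a + b).choose k ≤
      (a + b).choose a * (a ^ a * b ^ b) := by
    intro k hk
    have hk' : k ≤ a + b := Nat.le_of_lt_succ (mem_range.mp hk)
    have h1 := Nat.choose_mul_factorial_mul_factorial hk'
    have h2 := Nat.choose_mul_factorial_mul_factorial (Nat.le_add_right a b)
    rw [Nat.add_sub_cancel_left] at h2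
    have h3 := Nat.mul_le_mul (factorial_mul_pow_le_factorial_mul_pow k a)
      (factorial_mul_pow_le_factorial_mul_pow (a + b - k) b)
    refine Nat.le_of_mul_le_mul_left ?_
      (Nat.mul_pos (Nat.factorial_pos a) (Nat.factorial_pos b))
    calc a.factorial * b.factorial * (a ^ k * b ^ (a + b - k) * (a + b).choose k)
        = a.factorial * a ^ k * (b.factorial * b ^ (a + b - k)) * (a + b).choose k := by ring
      _ ≤ k.factorial * a ^ a * ((a + b - k).factorial * b ^ b) * (a + b).choose k :=
          Nat.mul_le_mul_right _ h3
      _ = (a + b).choose k * k.factorial * (a + b - k).factorial * (a ^ a * b ^ b) := by ring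
      _ = (a + b).choose a * a.factorial * b.factorial * (a ^ a * b ^ b) := by rw [h1, h2]
      _ = _ := by ring
  calc (a + b) ^ (a + b) = ∑ k ∈ range (a + b + 1), a ^ k * b ^ (a + b - k) * (a + b).choose k :=
        add_pow a b _
    _ ≤ _ := by simpa using sum_le_card_nsmul _ _ _ hterm

/-- A sphere of radius `w` has at least `exp (n H (w / n)) / (n + 1)` words, with the `q`-ary
entropy `H`. -/
theorem mul_qaryEntropy_le_log_sphereSize {q n w : ℕ} (hq : 2 ≤ q) (hn : 0 < n) (hw : w ≤ n) :
    n * Real.qaryEntropy q (w / n) ≤ Real.log (n + 1) + Real.log (sphereSize q n w) := by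
  obtain ⟨b, rfl⟩ := Nat.exists_eq_add_of_le hw
  have hq2 : (2 : ℝ) ≤ q := by exact_mod_cast hq
  have hn0 : (0 : ℝ) < (w + b : ℕ) := by exact_mod_cast hn
  have hC : (0 : ℝ) < (w + b).choose w := by exact_mod_cast Nat.choose_pos hw
  have hpp : ∀ m : ℕ, (0 : ℝ) < (m : ℝ) ^ m := fun m => by
    exact_mod_cast Nat.pow_self_pos
  have hlog : ((w + b : ℕ) : ℝ) * Real.log (w + b : ℕ) ≤ Real.log ((w + b : ℕ) + 1) +
      Real.log ((w + b).choose w) + (w * Real.log w + b * Real.log b) := by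
    have h : ((w + b : ℕ) : ℝ) ^ (w + b) ≤
        ((w + b : ℕ) + 1) * ((w + b).choose w * ((w : ℝ) ^ w * (b : ℝ) ^ b)) := by
      exact_mod_cast pow_add_self_le w b
    have h' := Real.log_le_log (hpp _) h
    rw [Real.log_pow, Real.log_mul (by positivity) (mul_pos hC (mul_pos (hpp _) (hpp _))).ne',
      Real.log_mul hC.ne' (mul_pos (hpp _) (hpp _)).ne', Real.log_mul (hpp _).ne' (hpp _).ne',
      Real.log_pow, Real.log_pow] at h'
    linarith
  have hσ : Real.log (sphereSize q (w + b) w) =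
      Real.log ((w + b).choose w) + w * Real.log ((q : ℝ) - 1) := by
    have : (0 : ℝ) < (q : ℝ) - 1 := by linarith
    rw [sphereSize, Real.log_mul hC.ne' (by positivity), Real.log_pow]
  have hdiv : ∀ m : ℕ, (m : ℝ) * Real.log (m / (w + b : ℕ)) =
      m * Real.log m - m * Real.log (w + b : ℕ) := by
    intro m
    rcases Nat.eq_zero_or_pos m with rfl | hm
    · simp
    · rw [Real.log_div (by exact_mod_cast hm.ne') hn0.ne']; ring
  have hcompl : 1 - (w : ℝ) / (w + b : ℕ) = b / (w + b : ℕ) := by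
    field_simp; push_cast; ring
  have hH : ((w + b : ℕ) : ℝ) * Real.qaryEntropy q (w / (w + b : ℕ)) =
      w * Real.log ((q : ℝ) - 1) - w * Real.log (w / (w + b : ℕ)) -
        b * Real.log (b / (w + b : ℕ)) := by
    rw [Real.qaryEntropy, Real.binEntropy_eq_negMulLog_add_negMulLog_one_sub, hcompl,
      Real.negMulLog, Real.negMulLog]
    push_cast
    push_cast at hn0
    field_simp
    ring
  rw [hH, hσ, hdiv, hdiv]
  push_cast at hlog ⊢
  linarith

theorem qEntropy_eq {q : ℕ} (hq : 2 ≤ q) (x : ℝ) :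
    qEntropy q x = Real.qaryEntropy q x / Real.log q := by
  have hq2 : (2 : ℝ) ≤ q := by exact_mod_cast hq
  have hq1 : (q : ℝ) - 1 ≠ 0 := by linarith
  rw [qEntropy, Real.qaryEntropy, Real.binEntropy_eq_negMulLog_add_negMulLog_one_sub,
    Real.negMulLog, Real.negMulLog, Real.logb, Real.logb]
  push_cast
  rcases eq_or_ne x 0 with rfl | hx
  · simp
  · rw [Real.log_div hx hq1]; ring

/-- The upper estimate uses absolute values because the real number of which `ebRadius` is the floor
is negative for the distance `0`. -/
theorem tendsto_ebRadius_div {q : ℕ} (hq : 2 ≤ q) {δ : ℝ} (hδ0 : 0 ≤ δ) :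
    Filter.Tendsto (fun n : ℕ => (ebRadius q n ⌊δ * n⌋₊ : ℝ) / n) Filter.atTop
      (nhds (johnson q δ)) := by
  have hd : Filter.Tendsto (fun n : ℕ => (⌊δ * n⌋₊ : ℝ) / n) Filter.atTop (nhds δ) :=
    (tendsto_nat_floor_mul_div_atTop hδ0).comp tendsto_natCast_atTop_atTop
  have hq2 : (2 : ℝ) ≤ q := by exact_mod_cast hq
  have hq1 : (0 : ℝ) < (q : ℝ) - 1 := by linarith
  set a : ℕ → ℝ := fun n => ((q : ℝ) - 1) / q * (1 - Real.sqrt (1 -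
    ((q : ℝ) * ((⌊δ * n⌋₊ : ℝ) / n) - 1 / n) / ((q : ℝ) - 1))) with ha
  have ha_lim : Filter.Tendsto a Filter.atTop (nhds (johnson q δ)) := by
    have h := ((((((hd.const_mul (q : ℝ)).sub tendsto_one_div_atTop_nhds_zero_nat).div_const
      ((q : ℝ) - 1)).const_sub 1).sqrt).const_sub 1).const_mul (((q : ℝ) - 1) / q)
    rw [sub_zero] at h
    exact h
  have hJ : 0 ≤ johnson q δ := by
    refine mul_nonneg (by positivity) (sub_nonneg.mpr (Real.sqrt_le_one.mpr ?_))
    have : 0 ≤ (q : ℝ) * δ / ((q : ℝ) - 1) := by positivity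
    linarith
  have hr : ∀ n : ℕ, 0 < n → ebRadius q n ⌊δ * n⌋₊ = ⌊a n * n⌋₊ := by
    intro n hn
    have hn0 : (n : ℝ) ≠ 0 := by exact_mod_cast hn.ne'
    have e : ((q : ℝ) * (⌊δ * n⌋₊ : ℝ) - 1) / (((q : ℝ) - 1) * n) =
        ((q : ℝ) * ((⌊δ * n⌋₊ : ℝ) / n) - 1 / n) / ((q : ℝ) - 1) := by
      field_simp
    rw [ebRadius, e]
    congr 1
    simp only [ha]
    ring
  have hlow : Filter.Tendsto (fun n : ℕ => a n - 1 / (n : ℝ)) Filter.atTop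
      (nhds (johnson q δ)) := by
    simpa using ha_lim.sub tendsto_one_div_atTop_nhds_zero_nat
  have hup : Filter.Tendsto (fun n : ℕ => |a n|) Filter.atTop (nhds (johnson q δ)) := by
    simpa [abs_of_nonneg hJ] using ha_lim.abs
  refine tendsto_of_tendsto_of_tendsto_of_le_of_le' hlow hup ?_ ?_
  · filter_upwards [Filter.eventually_gt_atTop 0] with n hn
    have hn0 : (0 : ℝ) < n := by exact_mod_cast hn
    rw [hr n hn, le_div_iff₀ hn0, sub_mul, one_div_mul_cancel hn0.ne']
    linarith [Nat.lt_floor_add_one (a n * n)]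
  · filter_upwards [Filter.eventually_gt_atTop 0] with n hn
    have hn0 : (0 : ℝ) < n := by exact_mod_cast hn
    rw [hr n hn, div_le_iff₀ hn0]
    calc (⌊a n * n⌋₊ : ℝ) ≤ (⌊|a n| * n⌋₊ : ℝ) := by
          exact_mod_cast Nat.floor_mono (mul_le_mul_of_nonneg_right (le_abs_self _) hn0.le)
      _ ≤ _ := Nat.floor_le (by positivity)

theorem rate_le_rateLP (hF : 2 ≤ Fintype.card F) (δ : ℝ) : rate F δ ≤ rateLP F δ := by
  have hq : (1 : ℝ) < Fintype.card F := by exact_mod_cast hF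
  refine Filter.limsup_le_limsup (Filter.Eventually.of_forall fun n => ?_)
  rw [EReal.coe_le_coe_iff]
  refine mul_le_mul_of_nonneg_left ?_ (by positivity)
  exact Real.logb_le_logb_of_le hq (by exact_mod_cast one_le_maxCodeSize hF n _)
    (maxCodeSize_le_hammingALP hF n _)

theorem rateLP_le (hF : 2 ≤ Fintype.card F) {δ : ℝ} (hδ0 : 0 ≤ δ)
    (hδ : δ ≤ ((Fintype.card F : ℝ) - 1) / Fintype.card F) :
    rateLP F δ ≤
      ((1 - qEntropy (Fintype.card F) (johnson (Fintype.card F) δ) : ℝ) : EReal) := by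
  set q := Fintype.card F with hqd
  have hq2 : (2 : ℝ) ≤ q := by exact_mod_cast hF
  have hlogq : 0 < Real.log q := Real.log_pos (by linarith)
  suffices h : ∃ b : ℕ → ℝ,
      (∀ᶠ n : ℕ in Filter.atTop, 1 / (n : ℝ) * Real.logb q (hammingALP F n ⌊δ * n⌋₊) ≤ b n) ∧
      Filter.Tendsto b Filter.atTop (nhds (1 - qEntropy q (johnson q δ))) by
    obtain ⟨b, hb, hlim⟩ := h
    have hlim' : Filter.Tendsto (fun n => (b n : EReal)) Filter.atTop
        (nhds ((1 - qEntropy q (johnson q δ) : ℝ) : EReal)) :=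
      (continuous_coe_real_ereal.tendsto _).comp hlim
    rw [← hlim'.limsup_eq]
    exact Filter.limsup_le_limsup (hb.mono fun n hn => EReal.coe_le_coe_iff.mpr hn)
  -- For `δ = 0` the distance is `0`, and the trivial bound `q ^ n` suffices.
  rcases hδ0.eq_or_lt with rfl | hδpos
  · refine ⟨fun _ => 1, ?_, ?_⟩
    · filter_upwards [Filter.eventually_gt_atTop 0] with n hn
      obtain ⟨u, hu, hval⟩ := (isGreatest_hammingALP hF n ⌊(0 : ℝ) * n⌋₊).1
      have h1 := hu.sum_le hF
      rw [← hval] at h1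
      have h2 := Real.logb_le_logb_of_le (b := q) (by linarith)
        (zero_lt_one.trans_le (one_le_hammingALP hF n _)) h1
      rw [← hqd, Real.logb_pow, Real.logb_self_eq_one (by linarith), mul_one] at h2
      have hn0 : (0 : ℝ) < n := by exact_mod_cast hn
      rw [one_div, inv_mul_le_iff₀ hn0, mul_one]
      exact h2
    · simp [johnson, qEntropy]
  · refine ⟨fun n => 1 + (Real.log q / n + 2 * (Real.log ((n : ℝ) + 1) / n) -
      Real.qaryEntropy q ((ebRadius q n ⌊δ * n⌋₊ : ℝ) / n)) / Real.log q, ?_, ?_⟩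
    · have hev : ∀ᶠ n : ℕ in Filter.atTop, 1 ≤ δ * n :=
        (tendsto_natCast_atTop_atTop.const_mul_atTop hδpos).eventually_ge_atTop 1
      filter_upwards [Filter.eventually_gt_atTop 0, hev] with n hn hδn
      have hn0 : (0 : ℝ) < n := by exact_mod_cast hn
      set d := ⌊δ * n⌋₊ with hd
      have hd1 : 1 ≤ d := Nat.le_floor (by simpa using hδn)
      have hdle : (d : ℝ) ≤ δ * n := Nat.floor_le (by positivity)
      have hdn : (d : ℝ) ≤ n * ((q : ℝ) - 1) / q := by
        refine hdle.trans ?_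
        rw [mul_comm, mul_div_assoc]
        exact mul_le_mul_of_nonneg_left hδ hn0.le
      have hd0 : (0 : ℝ) < d := by exact_mod_cast hd1
      obtain ⟨hwn, -⟩ := ebRadius_spec hF hn hd1 hdn
      have hσ := sphereSize_pos hF hwn
      have hdn1 : Real.log d ≤ Real.log ((n : ℝ) + 1) := by
        refine Real.log_le_log hd0 (hdn.trans ?_)
        rw [div_le_iff₀ (by linarith)]
        nlinarith
      have h1 := Real.log_le_log (zero_lt_one.trans_le (one_le_hammingALP hF n d))
        (hammingALP_le hF hn hd1 hdn)
      rw [← hqd, Real.log_mul (by positivity) (by positivity), Real.log_mul (by positivity)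
        (by positivity), Real.log_div (by positivity) hσ.ne', Real.log_pow] at h1
      have h2 := mul_qaryEntropy_le_log_sphereSize hF hn hwn
      have h3 : Real.log (hammingALP F n d) ≤ Real.log q + 2 * Real.log ((n : ℝ) + 1) +
          n * Real.log q - n * Real.qaryEntropy q ((ebRadius q n d : ℝ) / n) := by
        linarith
      rw [Real.logb]
      have e : 1 + (Real.log q / n + 2 * (Real.log ((n : ℝ) + 1) / n) -
          Real.qaryEntropy q ((ebRadius q n d : ℝ) / n)) / Real.log q = 1 / n *
          ((Real.log q + 2 * Real.log ((n : ℝ) + 1) + n * Real.log q -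
            n * Real.qaryEntropy q ((ebRadius q n d : ℝ) / n)) / Real.log q) := by
        field_simp
        ring
      rw [e]
      gcongr
    · have hH : Filter.Tendsto (fun n : ℕ =>
          Real.qaryEntropy q ((ebRadius q n ⌊δ * n⌋₊ : ℝ) / n)) Filter.atTop
          (nhds (Real.qaryEntropy q (johnson q δ))) :=
        (Real.qaryEntropy_continuous.tendsto _).comp (tendsto_ebRadius_div hF hδ0)
      have hl : Filter.Tendsto (fun n : ℕ => Real.log ((n : ℝ) + 1) / n) Filter.atTop
          (nhds 0) := by
        have h := (Real.tendsto_pow_log_div_mul_add_atTop 1 (-1) 1 one_ne_zero).comp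
          (Filter.tendsto_atTop_add_const_right _ (1 : ℝ) (tendsto_natCast_atTop_atTop (R := ℝ)))
        refine h.congr fun n => ?_
        simp
      have hc : Filter.Tendsto (fun n : ℕ => Real.log q / (n : ℝ)) Filter.atTop (nhds 0) :=
        tendsto_const_div_atTop_nhds_zero_nat _
      have := (((hc.add (hl.const_mul 2)).sub hH).div_const (Real.log q)).const_add 1
      convert this using 2
      rw [qEntropy_eq hF]
      ring

end DelsarteLP

theorem mainTheorem4 {F : Type*} [Fintype F] [DecidableEq F] (q : ℕ)
    (hF : Fintype.card F = q) (hq : 2 ≤ q) :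
    (∀ n d : ℕ, 2 ≤ n → (d : ℝ) ≤ (n : ℝ) * ((q : ℝ) - 1) / q →
      IsGreatest (DelsarteLP.lpValues n d (DelsarteLP.hammingQ F n)) (DelsarteLP.hammingALP F n d) ∧
      (DelsarteLP.maxCodeSize F n d : ℝ) ≤ DelsarteLP.hammingALP F n d ∧
      (1 ≤ d → DelsarteLP.hammingALP F n d ≤
        (q : ℝ) * d * ((q : ℝ) ^ n /
          ((n.choose (DelsarteLP.ebRadius q n d) : ℝ) *
            ((q : ℝ) - 1) ^ DelsarteLP.ebRadius q n d)))) ∧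
    (∀ δ : ℝ, 0 ≤ δ → δ ≤ ((q : ℝ) - 1) / q →
      DelsarteLP.rate F δ ≤ DelsarteLP.rateLP F δ ∧
      DelsarteLP.rateLP F δ ≤
        ((1 - DelsarteLP.qEntropy q (DelsarteLP.johnson q δ) : ℝ) : EReal)) := by
  subst hF
  exact ⟨fun n d hn hd => ⟨DelsarteLP.isGreatest_hammingALP hq n d,
    DelsarteLP.maxCodeSize_le_hammingALP hq n d,
    fun hd1 => DelsarteLP.hammingALP_le hq (by omega) hd1 hd⟩,
    fun δ hδ0 hδ => ⟨DelsarteLP.rate_le_rateLP hq δ, DelsarteLP.rateLP_le hq hδ0 hδ⟩⟩
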